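/- Let $q\ge 1$ and $m\ge 0$ be integers, and consider three qudits of local dimension $q$, numbered $1,2,3$. Let $W_1,V_1,\dots,W_m,V_m$ be independent Haar-random unitary operators on $\mathbb{C}^q\otimes\mathbb{C}^q$. The $m$-layer hybrid circuit on three qudits consists of $m$ successive convolutional layers; layer $l$ first applies $W_l$ to qudits $1,2$ and then $V_l$ to qudits $2,3$. It is applied to $|000\rangle$. Afterwards qudits $1,2$ are idle, and the rewinding circuit applies the inverses, in reverse order, of exactly those gates that act only on idle qudits, which gives the state $$|\psi\rangle=(W_1)_{12}^\dagger (W_2)_{12}^\dagger\cdots (W_m)_{12}^\dagger\,(V_m)_{23}(W_m)_{12}\cdots (V_1)_{23}(W_1)_{12}\,|000\rangle .$$ Let $F=\langle\psi|(|0\rangle\langle 0|_1\otimes I)|\psi\rangle$ be the fidelity of resetting the first qudit, and let $F_1^{n=3}(m)$ be its average over the independent Haar-random unitaries. Then $F$ is integrable and $$F_1^{n=3}(m)=\frac1q+\frac{q-1}{q}\left(\frac{1}{1+q^2}\right)^m .$$ Consequently $F_1^{n=3}(m)\to\frac1q$ as $m\to\infty$. -/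

import Mathlib

open MeasureTheory Filter Topology

noncomputable section

/-- Unitary operators on two qudits of local dimension `q`, as matrices in the
computational basis `|a, b⟩`. -/
abbrev TwoQuditUnitary (q : ℕ) : Type := Matrix.unitaryGroup (Fin q × Fin q) ℂ

instance TwoQuditUnitary.instMeasurableSpace (q : ℕ) : MeasurableSpace (TwoQuditUnitary q) :=
  borel _

instance TwoQuditUnitary.instBorelSpace (q : ℕ) : BorelSpace (TwoQuditUnitary q) := ⟨rfl⟩

instance TwoQuditUnitary.instCompactSpace (q : ℕ) : CompactSpace (TwoQuditUnitary q) := by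
  have hK : IsCompact (Set.pi Set.univ fun _ : Fin q × Fin q =>
      Set.pi Set.univ fun _ : Fin q × Fin q => Metric.closedBall (0 : ℂ) 1) :=
    isCompact_univ_pi fun _ => isCompact_univ_pi fun _ => isCompact_closedBall 0 1
  have hC : IsClosed {A : Matrix (Fin q × Fin q) (Fin q × Fin q) ℂ |
      A ∈ Matrix.unitaryGroup (Fin q × Fin q) ℂ} := by
    simp only [Matrix.mem_unitaryGroup_iff]
    exact isClosed_eq (continuous_id.mul continuous_star) continuous_const
  refine isCompact_iff_compactSpace.mp (IsCompact.of_isClosed_subset hK hC ?_)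
  intro A hA i _ j _
  simpa using entry_norm_bound_of_unitary hA i j

/-- The Haar probability measure on the unitary group of two qudits. -/
def haarTwoQudit (q : ℕ) : Measure (TwoQuditUnitary q) :=
  Measure.haarMeasure ⊤

instance haarTwoQudit.instIsHaarMeasure (q : ℕ) : (haarTwoQudit q).IsHaarMeasure :=
  Measure.isHaarMeasure_haarMeasure _

instance haarTwoQudit.instIsProbabilityMeasure (q : ℕ) :
    IsProbabilityMeasure (haarTwoQudit q) :=
  ⟨Measure.haarMeasure_self (K₀ := ⊤)⟩

/-- Computational basis labels `x = (x₁, …, xₙ)` of `n` qudits. -/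
abbrev QuditBasis (q n : ℕ) : Type := Fin n → Fin q

/-- State vectors of `n` qudits, in the computational basis. -/
abbrev QuditState (q n : ℕ) : Type := QuditBasis q n → ℂ

/-- The state `|0…0⟩`. -/
def zeroState (q n : ℕ) [NeZero q] : QuditState q n := Pi.single (fun _ => 0) 1

/-- A two-qudit gate placed on the ordered pair `(fst, snd)` of distinct qudits. -/
structure QuditGate (q n : ℕ) where
  fst : Fin n
  snd : Fin n
  ne : fst ≠ snd
  op : TwoQuditUnitary q

namespace QuditGate

variable {q n : ℕ}

/-- The operator of a gate on all `n` qudits: the two-qudit unitary on the pair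
`(fst, snd)`, tensored with the identity on all other qudits. -/
def toMatrix (g : QuditGate q n) : Matrix (QuditBasis q n) (QuditBasis q n) ℂ :=
  Matrix.of fun x y =>
    if ∀ k, k ≠ g.fst → k ≠ g.snd → x k = y k then
      (g.op : Matrix (Fin q × Fin q) (Fin q × Fin q) ℂ) (x g.fst, x g.snd) (y g.fst, y g.snd)
    else 0

/-- The inverse gate `g†`, on the same pair of qudits. -/
def dagger (g : QuditGate q n) : QuditGate q n := { g with op := star g.op }

/-- The gate acts only on qudits in `I`. -/
abbrev ActsOnlyOn (g : QuditGate q n) (I : Finset (Fin n)) : Prop := g.fst ∈ I ∧ g.snd ∈ I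

end QuditGate

/-- A circuit `(g₁, …, g_N)`, listed in order of application. -/
abbrev QuditCircuit (q n : ℕ) : Type := List (QuditGate q n)

namespace QuditCircuit

variable {q n : ℕ}

/-- The unitary `g_N ⋯ g₁` implemented by the circuit `(g₁, …, g_N)`. -/
def toMatrix : QuditCircuit q n → Matrix (QuditBasis q n) (QuditBasis q n) ℂ
  | [] => 1
  | g :: C => toMatrix C * g.toMatrix

/-- The rewinding circuit for the set `I` of idle qudits: if `(h₁, …, h_M)` is the subsequence
of those gates that act only on idle qudits, this is the circuit `(h_M†, …, h₁†)`. -/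
def rewinding (C : QuditCircuit q n) (I : Finset (Fin n)) : QuditCircuit q n :=
  ((C.filter fun g => decide (g.ActsOnlyOn I)).map QuditGate.dagger).reverse

/-- The state after running `C` on `|0…0⟩` and then its rewinding circuit. -/
def rewoundState [NeZero q] (C : QuditCircuit q n) (I : Finset (Fin n)) : QuditState q n :=
  ((C.rewinding I).toMatrix).mulVec (C.toMatrix.mulVec (zeroState q n))

end QuditCircuit

/-- The projector `|0⟩⟨0|` on the `k`-th qudit, tensored with the identity on the others. -/
def zeroProjector (q n : ℕ) [NeZero q] (k : Fin n) :
    Matrix (QuditBasis q n) (QuditBasis q n) ℂ :=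
  Matrix.diagonal fun x => if x k = 0 then 1 else 0

/-- The fidelity `⟨ψ| (|0⟩⟨0|_k ⊗ I) |ψ⟩` of resetting the `k`-th qudit. -/
def resetFidelity {q n : ℕ} [NeZero q] (k : Fin n) (ψ : QuditState q n) : ℂ :=
  dotProduct (star ψ) ((zeroProjector q n k).mulVec ψ)

/-- The two-qudit unitaries of an `m`-layer hybrid circuit on `n` qudits: the one with index
`(l, i)` is used in layer `l` on the neighbouring qudits `i` and `i + 1` (numbered from `0`). -/
abbrev HybridUnitaries (q n m : ℕ) : Type := Fin m × Fin (n - 1) → TwoQuditUnitary q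

/-- The `m`-layer hybrid circuit: `m` successive convolutional circuits, each of which
applies a two-qudit gate to the neighbouring pairs `(0, 1), (1, 2), …, (n - 2, n - 1)`
in this order. -/
def hybridCircuit {q n m : ℕ} (U : HybridUnitaries q n m) : QuditCircuit q n :=
  (List.ofFn fun l : Fin m => List.ofFn fun i : Fin (n - 1) =>
    (⟨⟨i, by omega⟩, ⟨i + 1, by omega⟩, by simp [Fin.ext_iff], U (l, i)⟩ :
      QuditGate q n)).flatten

/-- The idle qudits after a hybrid circuit: all but the last one, on which the rest of the
computation still acts. -/
def hybridIdle (n : ℕ) : Finset (Fin n) := Finset.univ.filter fun k => (k : ℕ) + 1 < n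

/-- The fidelity of resetting the `k`-th qudit by rewinding a given hybrid circuit. -/
def hybridFidelity {q n m : ℕ} [NeZero q] (k : Fin n) (U : HybridUnitaries q n m) : ℂ :=
  resetFidelity k ((hybridCircuit U).rewoundState (hybridIdle n))

/-- The law of independent Haar random two-qudit unitaries. -/
def hybridHaar (q n m : ℕ) : Measure (HybridUnitaries q n m) :=
  Measure.pi fun _ => haarTwoQudit q

/-- The average over all gates of the fidelity of resetting the `k`-th qudit. -/
def hybridAvgFidelity (q n m : ℕ) [NeZero q] (k : Fin n) : ℂ :=
  ∫ U, hybridFidelity k U ∂(hybridHaar q n m)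

end

noncomputable section

/-! ### Matrix algebra -/

section MatrixAlgebra

open Matrix

variable {n : Type*} [Fintype n] [DecidableEq n]

/-! By cyclicity of the trace the fidelity is Tr[K A K† · C R C†], where C is the whole circuit, K
the product of its gates on qudits 1,2, A = |0⟩⟨0| ⊗ I and R = |000⟩⟨000|. Keeping A and R arbitrary
gives a recursion: peeling off the first layer replaces A by W A W† and R by V W R W† V†
(`evolvedTrace_layer_append`).

The average of one layer closes on the two invariants Tr A · Tr R and Tr[(A ⊗ I) R]. The first is
unchanged by the gates. For the second, averaging over V erases the state of qudit 2
(`integral_trace_onFirstTwo_mul_conj`), leaving Tr[W A W† · D(W X W†)] with X the partial trace of R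
over qudit 3 and D the channel depolarizing qudit 2. Averaging over W gives r (Tr A Tr X + Tr AX)
with r = 1/(1+q²) (`integral_trace_unitaryConj_mul_depolarizeSnd`). Hence Tr[(A ⊗ I) R] is damped by
r per layer while Tr A Tr R collects a geometric series (`integral_evolvedTrace`). Inserting Tr A =
q, Tr R = 1 and Tr[(A ⊗ I) R] = 1 yields the formula, and |r| < 1 the limit.

The W-average needs no Weingarten calculus. The twirl of D commutes with unitary conjugation, so it
has the form X ↦ a Tr(X) 1 + b X (`exists_eq_trace_smul_one_add_smul`). Its value on 1 and its trace
as a linear map fix a and b. -/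

theorem one_add_smul_mem_unitaryGroup {P : Matrix n n ℂ} (hs : Pᴴ = P) (hP : P * P = P)
    {z : ℂ} (hz : z + star z + z * star z = 0) :
    1 + z • P ∈ unitaryGroup n ℂ := by
  rw [mem_unitaryGroup_iff, star_eq_conjTranspose]
  simp only [conjTranspose_add, conjTranspose_one, conjTranspose_smul, hs, mul_add, add_mul,
    one_mul, mul_one, smul_mul_smul_comm, hP]
  have : (1 + z • P + (star z • P + (z * star z) • P) : Matrix n n ℂ)
      = 1 + (z + star z + z * star z) • P := by
    simp only [add_smul]; abel
  rw [this, hz, zero_smul, add_zero]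

/-- Orthogonal projections span all matrices. -/
theorem Submodule.eq_top_of_projections_mem (S : Submodule ℂ (Matrix n n ℂ))
    (h : ∀ P : Matrix n n ℂ, Pᴴ = P → P * P = P → P ∈ S) : S = ⊤ := by
  have hdiag : ∀ i, single i i (1 : ℂ) ∈ S := fun i => h _ (by simp) (by simp)
  -- Twice the projection onto the line of e_i + w̄ e_j, minus the two diagonal matrix units.
  have hpair : ∀ i j, i ≠ j → ∀ w : ℂ, w * star w = 1 →
      w • single i j (1 : ℂ) + star w • single j i (1 : ℂ) ∈ S := by
    intro i j hij w hw
    have hw' : star w * w = 1 := by rw [mul_comm]; exact hw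
    have hmem := S.smul_mem (2 : ℂ) (h ((2⁻¹ : ℂ) • (single i i (1 : ℂ) + single j j (1 : ℂ)
      + (w • single i j (1 : ℂ) + star w • single j i (1 : ℂ)))) (by
        simp only [conjTranspose_smul, conjTranspose_add, conjTranspose_single, star_one, star_star]
        rw [show star (2⁻¹ : ℂ) = 2⁻¹ by simp]
        congr 2
        rw [add_comm]) (by
        simp only [smul_mul_smul_comm, mul_add, add_mul, smul_single, single_mul_single_same,
          single_mul_single_of_ne _ _ _ _ hij, single_mul_single_of_ne _ _ _ _ hij.symm]
        ext a b
        simp only [Matrix.smul_apply, Matrix.add_apply, single_apply, smul_eq_mul, mul_one, one_mul,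
          Matrix.zero_apply, hw, hw']
        split_ifs <;> ring))
    rw [smul_smul, mul_inv_cancel₀ two_ne_zero, one_smul] at hmem
    have := S.sub_mem hmem (S.add_mem (hdiag i) (hdiag j))
    rwa [add_sub_cancel_left] at this
  have hsingle : ∀ i j, single i j (1 : ℂ) ∈ S := by
    intro i j
    rcases eq_or_ne i j with rfl | hij
    · exact hdiag i
    -- The phases 1 and i isolate one matrix unit: (E_ij + E_ji) - i (i E_ij - i E_ji) = 2 E_ij.
    · have h1 := hpair i j hij 1 (by simp)
      have h2 := hpair i j hij Complex.I (by simp)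
      have h3 := S.smul_mem (2⁻¹ : ℂ) (S.sub_mem h1 (S.smul_mem Complex.I h2))
      convert h3 using 1
      ext a b
      simp only [Matrix.smul_apply, Matrix.sub_apply, Matrix.add_apply, smul_eq_mul, star_one,
        Complex.star_def, Complex.conj_I]
      linear_combination (1 / 2 : ℂ) * (single i j (1 : ℂ) a b - single j i (1 : ℂ) a b)
        * Complex.I_mul_I
  rw [eq_top_iff]
  intro A _
  rw [matrix_eq_sum_single A]
  refine S.sum_mem fun i _ => S.sum_mem fun j _ => ?_
  have := S.smul_mem (A i j) (hsingle i j)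
  rwa [smul_single, smul_eq_mul, mul_one] at this

/-- This is exp(iπP/2). Together with its inverse `unitary_sub_I` it passes from unitaries to
projections, which span linearly, without differentiating along one-parameter groups. -/
theorem unitary_add_I (P : Matrix n n ℂ) (hs : Pᴴ = P) (hP : P * P = P) :
    1 + (Complex.I - 1) • P ∈ unitaryGroup n ℂ :=
  one_add_smul_mem_unitaryGroup hs hP (by
    simp only [star_sub, star_one, Complex.star_def, Complex.conj_I]
    linear_combination -Complex.I_mul_I)

theorem unitary_sub_I (P : Matrix n n ℂ) (hs : Pᴴ = P) (hP : P * P = P) :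
    1 + (-Complex.I - 1) • P ∈ unitaryGroup n ℂ :=
  one_add_smul_mem_unitaryGroup hs hP (by
    simp only [star_sub, star_neg, star_one, Complex.star_def, Complex.conj_I]
    linear_combination -Complex.I_mul_I)

/-- A matrix which commutes with all unitary matrices is scalar. -/
theorem eq_smul_one_of_commute_unitary [Nonempty n] (Z : Matrix n n ℂ)
    (h : ∀ U ∈ unitaryGroup n ℂ, U * Z = Z * U) :
    Z = (Z.trace / Fintype.card n) • (1 : Matrix n n ℂ) := by
  have htop := Submodule.eq_top_of_projections_mem
    (LinearMap.ker (LinearMap.mulRight ℂ Z - LinearMap.mulLeft ℂ Z)) (by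
      intro P hs hP
      have h1 := h _ (unitary_add_I P hs hP)
      simp only [add_mul, mul_add, one_mul, mul_one, smul_mul_assoc, mul_smul_comm,
        add_right_inj] at h1
      have hne : (Complex.I - 1 : ℂ) ≠ 0 := by
        intro h0
        simpa using congrArg Complex.im h0
      have h2 : P * Z = Z * P := smul_right_injective _ hne h1
      simp [LinearMap.mem_ker, h2])
  have hcomm : ∀ A, A * Z = Z * A := by
    intro A
    have : A ∈ (⊤ : Submodule ℂ (Matrix n n ℂ)) := trivial
    rw [← htop] at this
    simpa [LinearMap.mem_ker, sub_eq_zero] using this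
  obtain ⟨c, rfl⟩ := mem_range_scalar_of_commute_single (M := Z) fun i j _ => hcomm _
  have hc : (Fintype.card n : ℂ) ≠ 0 := by simp
  simp [Matrix.scalar_apply, ← Matrix.smul_one_eq_diagonal, hc]

/-- A linear map on matrices which commutes with unitary conjugation also commutes with
commutators. -/
theorem map_commutator_of_map_unitary_conj (Ψ : Matrix n n ℂ →ₗ[ℂ] Matrix n n ℂ)
    (h : ∀ U ∈ unitaryGroup n ℂ, ∀ X, Ψ (U * X * Uᴴ) = U * Ψ X * Uᴴ) (A X : Matrix n n ℂ) :
    Ψ (A * X - X * A) = A * Ψ X - Ψ X * A := by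
  have key : ∀ P : Matrix n n ℂ, Pᴴ = P → P * P = P → ∀ X,
      Ψ (P * X - X * P) = P * Ψ X - Ψ X * P := by
    intro P hs hP X
    -- In (1 + zP) Y (1 + zP)† the term in PYP has coefficient |z|², the same for z = ±i - 1. The
    -- difference therefore leaves exactly 2i [P, Y].
    have hd : ∀ Y : Matrix n n ℂ, P * Y - Y * P = (2 * Complex.I)⁻¹ •
        ((1 + (Complex.I - 1) • P) * Y * (1 + (Complex.I - 1) • P)ᴴ
          - (1 + (-Complex.I - 1) • P) * Y * (1 + (-Complex.I - 1) • P)ᴴ) := by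
      intro Y
      rw [eq_inv_smul_iff₀ (by simp)]
      simp only [conjTranspose_add, conjTranspose_one, conjTranspose_smul, hs, star_sub, star_neg,
        star_one, Complex.star_def, Complex.conj_I, add_mul, mul_add, one_mul, mul_one,
        smul_mul_assoc, mul_smul_comm, smul_add, smul_sub, smul_smul]
      module
    rw [hd X, map_smul, map_sub, h _ (unitary_add_I P hs hP), h _ (unitary_sub_I P hs hP), ← hd]
  have htop := Submodule.eq_top_of_projections_mem
    (LinearMap.ker ((LinearMap.compRight ℂ Ψ) ∘ₗ
      (LinearMap.mul ℂ (Matrix n n ℂ) - (LinearMap.mul ℂ (Matrix n n ℂ)).flip)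
      - (LinearMap.lcomp ℂ _ Ψ) ∘ₗ
      (LinearMap.mul ℂ (Matrix n n ℂ) - (LinearMap.mul ℂ (Matrix n n ℂ)).flip))) (by
      intro P hs hP
      rw [LinearMap.mem_ker]
      ext1 Y
      have := key P hs hP Y
      simpa [sub_eq_zero] using this)
  have hA : A ∈ (⊤ : Submodule ℂ (Matrix n n ℂ)) := trivial
  rw [← htop, LinearMap.mem_ker] at hA
  have := LinearMap.congr_fun hA X
  simpa [sub_eq_zero] using this

/-- A linear map on matrices which commutes with unitary conjugation is a combination of the
trace and the identity. -/
theorem exists_eq_trace_smul_one_add_smul [Nonempty n] (Ψ : Matrix n n ℂ →ₗ[ℂ] Matrix n n ℂ)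
    (h : ∀ U ∈ unitaryGroup n ℂ, ∀ X, Ψ (U * X * Uᴴ) = U * Ψ X * Uᴴ) :
    ∃ a b : ℂ, ∀ X, Ψ X = (a * X.trace) • (1 : Matrix n n ℂ) + b • X := by
  have hcomm := map_commutator_of_map_unitary_conj Ψ h
  obtain ⟨o⟩ := ‹Nonempty n›
  -- Ψ(E_oo) inherits the commutant of E_oo. This forces it to be diagonal with equal entries away
  -- from o, that is, a·1 + b·E_oo.
  have hD : ∀ A, A * single o o (1 : ℂ) = single o o (1 : ℂ) * A →
      A * Ψ (single o o 1) = Ψ (single o o 1) * A := by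
    intro A hA
    have := hcomm A (single o o 1)
    rw [hA, sub_self, map_zero] at this
    exact (sub_eq_zero.mp this.symm)
  obtain ⟨a, ha⟩ : ∃ a, ∀ j, j ≠ o → Ψ (single o o 1) j j = a := by
    by_cases hex : ∃ k, k ≠ o
    · obtain ⟨k, hk⟩ := hex
      refine ⟨Ψ (single o o 1) k k, fun j hj => ?_⟩
      have := congrFun (congrFun (hD (single j k 1) (by
        rw [single_mul_single_of_ne _ _ _ _ hk, single_mul_single_of_ne _ _ _ _ hj.symm])) j) k
      simpa using this.symm
    -- With a single index a is arbitrary, since trace times 1 and the identity map coincide; b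
    -- absorbs the choice.
    · exact ⟨0, fun j hj => (hex ⟨j, hj⟩).elim⟩
  have hoff : ∀ j k, j ≠ k → Ψ (single o o 1) j k = 0 := by
    intro j k hjk
    have := congrFun (congrFun (hD (single j j 1) (by
      rcases eq_or_ne j o with rfl | hj
      · rfl
      · rw [single_mul_single_of_ne _ _ _ _ hj, single_mul_single_of_ne _ _ _ _ hj.symm])) j) k
    simpa [Matrix.mul_apply, single_apply, hjk, hjk.symm] using this
  set b := Ψ (single o o 1) o o - a with hb
  refine ⟨a, b, ?_⟩
  let Θ : Matrix n n ℂ →ₗ[ℂ] Matrix n n ℂ :=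
    Ψ - (a • (traceLinearMap n ℂ ℂ).smulRight (1 : Matrix n n ℂ) + b • LinearMap.id)
  have hΘ : ∀ X, Θ X = Ψ X - ((a * X.trace) • (1 : Matrix n n ℂ) + b • X) := by
    intro X; simp [Θ, smul_smul]
  -- Commutators have trace zero, so the kernel of the defect Θ is stable under them. From E_oo they
  -- reach every matrix unit: [E_jo, E_oo] = E_jo for j ≠ o, and [E_ok, E_jo] = δ_jk E_oo - E_jk.
  have hΘcomm : ∀ A X, Θ X = 0 → Θ (A * X - X * A) = 0 := by
    intro A X hX
    rw [hΘ, sub_eq_zero] at hX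
    rw [hΘ, hcomm, hX, trace_sub, trace_mul_comm A X]
    simp [mul_add, add_mul, smul_sub]
  have h0 : Θ (single o o 1) = 0 := by
    rw [hΘ, sub_eq_zero]
    ext j k
    rcases eq_or_ne j k with rfl | hjk
    · rcases eq_or_ne j o with rfl | hj
      · simp [hb]
      · simp [ha j hj, hj.symm]
    · rw [hoff j k hjk]
      simp only [Matrix.add_apply, Matrix.smul_apply, Matrix.one_apply_ne hjk, single_apply]
      rw [if_neg (by rintro ⟨rfl, rfl⟩; exact hjk rfl)]
      simp
  have h1 : ∀ j, Θ (single j o 1) = 0 := by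
    intro j
    rcases eq_or_ne j o with rfl | hj
    · exact h0
    · have := hΘcomm (single j o 1) (single o o 1) h0
      rwa [single_mul_single_of_ne _ _ _ _ hj.symm, single_mul_single_same, mul_one,
        sub_zero] at this
  have h2 : ∀ j k, Θ (single j k 1) = 0 := by
    intro j k
    have := hΘcomm (single o k 1) (single j o 1) (h1 j)
    rw [single_mul_single_same, mul_one, map_sub, sub_eq_zero] at this
    rw [← this]
    rcases eq_or_ne k j with rfl | hkj
    · rw [single_mul_single_same, mul_one, h0]
    · rw [single_mul_single_of_ne _ _ _ _ hkj, map_zero]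
  intro X
  rw [← sub_eq_zero, ← hΘ, matrix_eq_sum_single X, map_sum]
  refine Finset.sum_eq_zero fun i _ => ?_
  rw [map_sum]
  refine Finset.sum_eq_zero fun j _ => ?_
  have : single i j (X i j) = X i j • single i j (1 : ℂ) := by simp [smul_single]
  rw [this, map_smul, h2, smul_zero]

end MatrixAlgebra

/-! ### Haar measure on two-qudit unitaries -/

/-- Second countability makes continuous functions of several gates measurable for the product
σ-algebra. -/
instance TwoQuditUnitary.instSecondCountableTopology (q : ℕ) :
    SecondCountableTopology (TwoQuditUnitary q) :=
  haveI : SecondCountableTopology (Matrix (Fin q × Fin q) (Fin q × Fin q) ℂ) :=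
    inferInstanceAs (SecondCountableTopology ((Fin q × Fin q) → (Fin q × Fin q) → ℂ))
  Topology.IsEmbedding.subtypeVal.secondCountableTopology

/-- A right translate of Haar measure is still left invariant and of mass one, so uniqueness
identifies it with the original. -/
instance haarTwoQudit.instIsMulRightInvariant (q : ℕ) : (haarTwoQudit q).IsMulRightInvariant where
  map_mul_right_eq_self g := by
    have : IsProbabilityMeasure ((haarTwoQudit q).map (· * g)) :=
      Measure.isProbabilityMeasure_map (measurable_mul_const g).aemeasurable
    exact Measure.isHaarMeasure_eq_of_isProbabilityMeasure _ _


/-! ### Averages over the unitary group -/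

section Twirl

open Matrix

attribute [local instance] Matrix.normedAddCommGroup Matrix.normedSpace

/-- Operators on two qudits. -/
abbrev TwoQuditOp (q : ℕ) : Type := Matrix (Fin q × Fin q) (Fin q × Fin q) ℂ

/-- Conjugation `X ↦ U X U†`. -/
def unitaryConj {q : ℕ} (U : TwoQuditUnitary q) : TwoQuditOp q →ₗ[ℂ] TwoQuditOp q :=
  LinearMap.mulLeft ℂ (U : TwoQuditOp q) ∘ₗ LinearMap.mulRight ℂ (U : TwoQuditOp q)ᴴ

variable {q : ℕ}

theorem unitaryConj_apply (U : TwoQuditUnitary q) (X : TwoQuditOp q) :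
    unitaryConj U X = U * X * (U : TwoQuditOp q)ᴴ := by
  simp [unitaryConj, mul_assoc]

theorem unitaryConj_mul (U V : TwoQuditUnitary q) (X : TwoQuditOp q) :
    unitaryConj (U * V) X = unitaryConj U (unitaryConj V X) := by
  simp [unitaryConj_apply, mul_assoc]

theorem unitaryConj_one (X : TwoQuditOp q) : unitaryConj (1 : TwoQuditUnitary q) X = X := by
  simp [unitaryConj_apply]

theorem unitaryConj_self_inv (U : TwoQuditUnitary q) (X : TwoQuditOp q) :
    unitaryConj U (unitaryConj U⁻¹ X) = X := by
  rw [← unitaryConj_mul, mul_inv_cancel, unitaryConj_one]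

theorem trace_unitaryConj (U : TwoQuditUnitary q) (X : TwoQuditOp q) :
    (unitaryConj U X).trace = X.trace := by
  have h : (U : TwoQuditOp q)ᴴ * U = 1 := by
    rw [← star_eq_conjTranspose]; exact Unitary.coe_star_mul_self U
  rw [unitaryConj_apply, trace_mul_comm, ← mul_assoc, h, one_mul]

theorem trace_unitaryConj_mul (U : TwoQuditUnitary q) (X Y : TwoQuditOp q) :
    (unitaryConj U X * Y).trace = (X * unitaryConj U⁻¹ Y).trace := by
  have h : ((U⁻¹ : TwoQuditUnitary q) : TwoQuditOp q) = (U : TwoQuditOp q)ᴴ := rfl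
  rw [unitaryConj_apply, unitaryConj_apply, h, conjTranspose_conjTranspose]
  rw [mul_assoc, mul_assoc, trace_mul_comm]
  simp only [mul_assoc]

theorem continuous_unitaryConj {α : Type*} [TopologicalSpace α] {g : α → TwoQuditUnitary q}
    {f : α → TwoQuditOp q} (hg : Continuous g) (hf : Continuous f) :
    Continuous fun x => unitaryConj (g x) (f x) := by
  have hg' : Continuous fun x => (g x : TwoQuditOp q) := continuous_subtype_val.comp hg
  simp only [unitaryConj_apply]
  exact (hg'.mul hf).mul hg'.matrix_conjTranspose

theorem integral_linearMap_comp {E : Type*} [NormedAddCommGroup E] [NormedSpace ℂ E]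
    [CompleteSpace E] (L : TwoQuditOp q →ₗ[ℂ] E)
    {f : TwoQuditUnitary q → TwoQuditOp q} (hf : Continuous f) :
    ∫ U, L (f U) ∂haarTwoQudit q = L (∫ U, f U ∂haarTwoQudit q) :=
  ContinuousLinearMap.integral_comp_comm (LinearMap.toContinuousLinearMap L)
    (hf.integrable_of_hasCompactSupport (HasCompactSupport.of_compactSpace f))

theorem continuous_linearMap (L : TwoQuditOp q →ₗ[ℂ] TwoQuditOp q) : Continuous L :=
  L.continuous_of_finiteDimensional

/-- The Haar average of `V X V†`. -/
theorem integral_unitaryConj [NeZero q] (X : TwoQuditOp q) :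
    ∫ V, unitaryConj V X ∂haarTwoQudit q = (X.trace / (q : ℂ) ^ 2) • (1 : TwoQuditOp q) := by
  have hc : Continuous fun V : TwoQuditUnitary q => unitaryConj V X :=
    continuous_unitaryConj continuous_id continuous_const
  have hZ : ∀ U : TwoQuditUnitary q, unitaryConj U (∫ V, unitaryConj V X ∂haarTwoQudit q)
      = ∫ V, unitaryConj V X ∂haarTwoQudit q := by
    intro U
    rw [← integral_linearMap_comp _ hc]
    simp only [← unitaryConj_mul]
    exact integral_mul_left_eq_self (fun V => unitaryConj V X) U
  rw [eq_smul_one_of_commute_unitary (∫ V, unitaryConj V X ∂haarTwoQudit q) ?_]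
  · have htr := integral_linearMap_comp (traceLinearMap (Fin q × Fin q) ℂ ℂ) hc
    simp only [traceLinearMap_apply, trace_unitaryConj] at htr
    rw [← htr]
    simp [sq]
  · intro U hU
    have h := hZ ⟨U, hU⟩
    rw [unitaryConj_apply] at h
    have h' : Uᴴ * U = 1 := by
      rw [← star_eq_conjTranspose]; exact (mem_unitaryGroup_iff'.mp hU)
    conv_rhs => rw [← h]
    rw [mul_assoc _ Uᴴ U, h', mul_one]

theorem continuous_twirl_integrand (Φ : TwoQuditOp q →ₗ[ℂ] TwoQuditOp q) (X : TwoQuditOp q) :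
    Continuous fun W : TwoQuditUnitary q => unitaryConj W⁻¹ (Φ (unitaryConj W X)) :=
  continuous_unitaryConj continuous_inv
    ((continuous_linearMap Φ).comp (continuous_unitaryConj continuous_id continuous_const))

/-- The average of `X ↦ W† Φ(W X W†) W` over the Haar measure. -/
def haarTwirl (Φ : TwoQuditOp q →ₗ[ℂ] TwoQuditOp q) : TwoQuditOp q →ₗ[ℂ] TwoQuditOp q where
  toFun X := ∫ W, unitaryConj W⁻¹ (Φ (unitaryConj W X)) ∂haarTwoQudit q
  map_add' X Y := by
    refine (integral_congr_ae (ae_of_all _ fun W => by simp only [map_add])).trans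
      (integral_add
        ((continuous_twirl_integrand Φ X).integrable_of_hasCompactSupport
          (HasCompactSupport.of_compactSpace _))
        ((continuous_twirl_integrand Φ Y).integrable_of_hasCompactSupport
          (HasCompactSupport.of_compactSpace _)))
  map_smul' c X := by
    rw [RingHom.id_apply, ← integral_smul]
    exact integral_congr_ae (ae_of_all _ fun W => by simp only [map_smul])

theorem haarTwirl_apply (Φ : TwoQuditOp q →ₗ[ℂ] TwoQuditOp q) (X : TwoQuditOp q) :
    haarTwirl Φ X = ∫ W, unitaryConj W⁻¹ (Φ (unitaryConj W X)) ∂haarTwoQudit q := rfl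

/-- The substitution W ↦ W U in the average, allowed by right invariance, turns W† into U† W†; the
outer conjugation by U cancels the U†. -/
theorem haarTwirl_unitaryConj (Φ : TwoQuditOp q →ₗ[ℂ] TwoQuditOp q) (U : TwoQuditUnitary q)
    (X : TwoQuditOp q) : haarTwirl Φ (unitaryConj U X) = unitaryConj U (haarTwirl Φ X) := by
  rw [haarTwirl_apply, haarTwirl_apply,
    ← integral_linearMap_comp _ (continuous_twirl_integrand Φ X)]
  rw [← integral_mul_right_eq_self
    (fun W => unitaryConj U (unitaryConj W⁻¹ (Φ (unitaryConj W X)))) U]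
  refine integral_congr_ae (ae_of_all _ fun W => ?_)
  simp only [unitaryConj_mul, _root_.mul_inv_rev, unitaryConj_self_inv]

theorem trace_haarTwirl_one [NeZero q] (Φ : TwoQuditOp q →ₗ[ℂ] TwoQuditOp q) :
    (haarTwirl Φ 1).trace = (Φ 1).trace := by
  have h1 : ∀ W : TwoQuditUnitary q, unitaryConj W (1 : TwoQuditOp q) = 1 := by
    intro W
    rw [unitaryConj_apply, mul_one, ← star_eq_conjTranspose]
    exact Unitary.coe_mul_star_self W
  have h := integral_linearMap_comp (traceLinearMap (Fin q × Fin q) ℂ ℂ)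
    (continuous_twirl_integrand Φ 1)
  simp only [traceLinearMap_apply, trace_unitaryConj, h1] at h
  rw [haarTwirl_apply]
  simp only [h1]
  rw [← h]
  simp

theorem trace_eq_sum_apply_single (Φ : TwoQuditOp q →ₗ[ℂ] TwoQuditOp q) :
    LinearMap.trace ℂ _ Φ = ∑ p : (Fin q × Fin q) × (Fin q × Fin q),
      Φ (single p.1 p.2 1) p.1 p.2 := by
  rw [LinearMap.trace_eq_matrix_trace ℂ (stdBasis ℂ (Fin q × Fin q) (Fin q × Fin q)), trace]
  refine Finset.sum_congr rfl fun p _ => ?_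
  rw [diag_apply, LinearMap.toMatrix_apply, stdBasis_eq_single]
  rfl

theorem linearMap_trace_haarTwirl [NeZero q] (Φ : TwoQuditOp q →ₗ[ℂ] TwoQuditOp q) :
    LinearMap.trace ℂ _ (haarTwirl Φ) = LinearMap.trace ℂ _ Φ := by
  have hW : ∀ W : TwoQuditUnitary q, ∑ p : (Fin q × Fin q) × (Fin q × Fin q),
      unitaryConj W⁻¹ (Φ (unitaryConj W (single p.1 p.2 1))) p.1 p.2
        = LinearMap.trace ℂ _ Φ := by
    intro W
    -- The twirl averages conjugates of Φ by invertible maps, all with the same trace as Φ, so the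
    -- integrand is constant.
    have h := LinearMap.trace_mul_comm ℂ (unitaryConj W⁻¹) (Φ * unitaryConj W)
    have h' : Φ * unitaryConj W * unitaryConj W⁻¹ = Φ := by
      ext1 X
      simp [unitaryConj_self_inv]
    rw [h', trace_eq_sum_apply_single] at h
    exact h
  rw [trace_eq_sum_apply_single]
  have hent : ∀ p : (Fin q × Fin q) × (Fin q × Fin q),
      haarTwirl Φ (single p.1 p.2 1) p.1 p.2
        = ∫ W, unitaryConj W⁻¹ (Φ (unitaryConj W (single p.1 p.2 1))) p.1 p.2
          ∂haarTwoQudit q := fun p =>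
    (integral_linearMap_comp (entryLinearMap ℂ ℂ p.1 p.2)
      (continuous_twirl_integrand Φ (single p.1 p.2 1))).symm
  simp only [hent]
  rw [← integral_finsetSum]
  · simp [hW]
  · intro p _
    exact ((continuous_twirl_integrand Φ (single p.1 p.2 1)).matrix_elem p.1 p.2
      ).integrable_of_hasCompactSupport (HasCompactSupport.of_compactSpace _)

/-- The channel which replaces the second qudit by a maximally mixed one. -/
def depolarizeSnd (q : ℕ) : TwoQuditOp q →ₗ[ℂ] TwoQuditOp q where
  toFun X := of fun x y => if x.2 = y.2 then (q : ℂ)⁻¹ * ∑ w, X (x.1, w) (y.1, w) else 0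
  map_add' X Y := by
    ext x y
    simp only [of_apply, Matrix.add_apply, Finset.sum_add_distrib, mul_add]
    split_ifs <;> simp
  map_smul' c X := by
    ext x y
    simp only [of_apply, Matrix.smul_apply, smul_eq_mul, ← Finset.mul_sum, RingHom.id_apply]
    split_ifs
    · ring
    · simp

theorem depolarizeSnd_apply (X : TwoQuditOp q) (x y : Fin q × Fin q) :
    depolarizeSnd q X x y = if x.2 = y.2 then (q : ℂ)⁻¹ * ∑ w, X (x.1, w) (y.1, w) else 0 := rfl

theorem depolarizeSnd_one [NeZero q] : depolarizeSnd q 1 = 1 := by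
  ext x y
  have hq : (q : ℂ) ≠ 0 := NeZero.ne _
  rw [depolarizeSnd_apply]
  by_cases h1 : x.1 = y.1 <;> by_cases h2 : x.2 = y.2 <;>
    simp [one_apply, Prod.ext_iff, h1, h2, hq]

/-- The channel is a tensor product: the identity on operators of the first qudit, of trace q², and
the rank-one projection X ↦ Tr(X) 1/q, of trace 1. -/
theorem trace_depolarizeSnd [NeZero q] :
    LinearMap.trace ℂ _ (depolarizeSnd q) = (q : ℂ) ^ 2 := by
  have hq : (q : ℂ) ≠ 0 := NeZero.ne _
  rw [trace_eq_sum_apply_single]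
  simp only [depolarizeSnd_apply, Fintype.sum_prod_type, single_apply, Prod.mk.injEq]
  simp [ite_and, hq, sq]

theorem trace_mul_trace_of_unique (X Y : TwoQuditOp 1) :
    X.trace * Y.trace = (X * Y).trace := by
  simp [trace, mul_apply, Fintype.sum_prod_type]

theorem one_add_sq_ne_zero (q : ℕ) : 1 + (q : ℂ) ^ 2 ≠ 0 := by
  have : ((1 + q ^ 2 : ℕ) : ℂ) ≠ 0 := Nat.cast_ne_zero.mpr (by positivity)
  simpa using this

/-- The second moment of the Haar measure that governs one layer of the circuit. -/
theorem integral_trace_unitaryConj_mul_depolarizeSnd [NeZero q] (P X : TwoQuditOp q) :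
    ∫ W, (unitaryConj W P * depolarizeSnd q (unitaryConj W X)).trace ∂haarTwoQudit q
      = (P.trace * X.trace + (P * X).trace) / (1 + (q : ℂ) ^ 2) := by
  have hq : (q : ℂ) ≠ 0 := NeZero.ne _
  have hq2 := one_add_sq_ne_zero q
  obtain ⟨a, b, hab⟩ := exists_eq_trace_smul_one_add_smul (haarTwirl (depolarizeSnd q)) (by
    intro U hU X
    have := haarTwirl_unitaryConj (depolarizeSnd q) ⟨U, hU⟩ X
    rwa [unitaryConj_apply, unitaryConj_apply] at this)
  have hint : ∫ W, (unitaryConj W P * depolarizeSnd q (unitaryConj W X)).trace ∂haarTwoQudit q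
      = a * (P.trace * X.trace) + b * (P * X).trace := by
    have h := integral_linearMap_comp (traceLinearMap (Fin q × Fin q) ℂ ℂ ∘ₗ LinearMap.mulLeft ℂ P)
      (continuous_twirl_integrand (depolarizeSnd q) X)
    simp only [LinearMap.comp_apply, LinearMap.mulLeft_apply, traceLinearMap_apply] at h
    simp only [trace_unitaryConj_mul]
    rw [h, ← haarTwirl_apply, hab]
    simp [mul_add]
    ring
  have e1 : a * (q : ℂ) ^ 2 + b = 1 := by
    have h := trace_haarTwirl_one (depolarizeSnd q)
    rw [hab, depolarizeSnd_one] at h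
    simp [trace_one] at h
    have hne : (q : ℂ) * q ≠ 0 := mul_ne_zero hq hq
    apply mul_right_cancel₀ hne
    linear_combination h
  have e2 : a + b * (q : ℂ) ^ 2 = 1 := by
    have h := linearMap_trace_haarTwirl (depolarizeSnd q)
    rw [trace_depolarizeSnd, trace_eq_sum_apply_single] at h
    simp only [hab] at h
    simp [Fintype.sum_prod_type, trace, single_apply, one_apply, Finset.sum_add_distrib,
      Finset.filter_eq] at h
    have hne : (q : ℂ) * q ≠ 0 := mul_ne_zero hq hq
    apply mul_right_cancel₀ hne
    linear_combination h
  rw [hint, eq_div_iff hq2]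
  -- Subtracting `e1` and `e2` gives (a - b)(q² - 1) = 0. For q = 1 the two equations coincide, but
  -- then Tr P · Tr X = Tr(PX) and only a + b matters.
  rcases eq_or_ne q 1 with rfl | h1
  · rw [trace_mul_trace_of_unique]
    push_cast at e1 ⊢
    linear_combination 2 * (P * X).trace * e1
  · have hne : (q : ℂ) ^ 2 - 1 ≠ 0 := by
      rw [sub_ne_zero]
      exact_mod_cast (by
        intro h
        exact h1 (by nlinarith [Nat.pos_of_ne_zero (NeZero.ne q)]) : q ^ 2 ≠ 1)
    have hab' : a = b := by
      have : (a - b) * ((q : ℂ) ^ 2 - 1) = 0 := by linear_combination e1 - e2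
      rcases mul_eq_zero.mp this with h | h
      · exact sub_eq_zero.mp h
      · exact (hne h).elim
    subst hab'
    linear_combination (P.trace * X.trace + (P * X).trace) * e1

end Twirl

/-! ### Three qudits -/

section ThreeQudits

open Matrix

/-- Operators on three qudits. -/
abbrev ThreeQuditOp (q : ℕ) : Type := Matrix (QuditBasis q 3) (QuditBasis q 3) ℂ

variable {q : ℕ}

/-- `A ⊗ I`, with `A` acting on the first two qudits. -/
def onFirstTwo (A : TwoQuditOp q) : ThreeQuditOp q :=
  of fun x y => if x 2 = y 2 then A (x 0, x 1) (y 0, y 1) else 0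

/-- `I ⊗ A`, with `A` acting on the last two qudits. -/
def onLastTwo (A : TwoQuditOp q) : ThreeQuditOp q :=
  of fun x y => if x 0 = y 0 then A (x 1, x 2) (y 1, y 2) else 0

/-- The partial trace over the third qudit. -/
def traceThird (R : ThreeQuditOp q) : TwoQuditOp q :=
  of fun x y => ∑ c, R ![x.1, x.2, c] ![y.1, y.2, c]

/-- The block `⟨a| R |b⟩` with respect to the first qudit. -/
def firstBlock (R : ThreeQuditOp q) (a b : Fin q) : TwoQuditOp q :=
  of fun x y => R ![a, x.1, x.2] ![b, y.1, y.2]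

theorem sum_quditBasis_three {M : Type*} [AddCommMonoid M] (f : QuditBasis q 3 → M) :
    ∑ x, f x = ∑ a, ∑ b, ∑ c, f ![a, b, c] := by
  let e : Fin q × Fin q × Fin q ≃ QuditBasis q 3 :=
    { toFun := fun t => ![t.1, t.2.1, t.2.2]
      invFun := fun x => (x 0, x 1, x 2)
      left_inv := fun t => rfl
      right_inv := fun x => by ext i; fin_cases i <;> rfl }
  rw [← e.sum_comp, Fintype.sum_prod_type]
  refine Finset.sum_congr rfl fun a _ => ?_
  rw [Fintype.sum_prod_type]
  rfl

theorem quditBasis_three_ext {x y : QuditBasis q 3} :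
    x = y ↔ x 0 = y 0 ∧ x 1 = y 1 ∧ x 2 = y 2 := by
  constructor
  · rintro rfl; simp
  · rintro ⟨h0, h1, h2⟩
    ext i
    fin_cases i <;> simp_all

theorem onFirstTwo_one : onFirstTwo (1 : TwoQuditOp q) = 1 := by
  ext x y
  simp only [onFirstTwo, of_apply, one_apply, quditBasis_three_ext (x := x), Prod.mk.injEq,
    ← ite_and]
  congr 1
  rw [eq_iff_iff]
  tauto

theorem onLastTwo_one : onLastTwo (1 : TwoQuditOp q) = 1 := by
  ext x y
  simp only [onLastTwo, of_apply, one_apply, quditBasis_three_ext (x := x), Prod.mk.injEq,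
    ← ite_and]

theorem onFirstTwo_mul_apply (A : TwoQuditOp q) (R : ThreeQuditOp q) (x y : QuditBasis q 3) :
    (onFirstTwo A * R) x y = ∑ p : Fin q × Fin q, A (x 0, x 1) p * R ![p.1, p.2, x 2] y := by
  simp only [onFirstTwo, mul_apply, of_apply, sum_quditBasis_three, Fintype.sum_prod_type]
  refine Finset.sum_congr rfl fun a _ => Finset.sum_congr rfl fun b _ => ?_
  rw [Finset.sum_eq_single (x 2)] <;> simp +contextual [eq_comm]

theorem mul_onFirstTwo_apply (A : TwoQuditOp q) (R : ThreeQuditOp q) (x y : QuditBasis q 3) :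
    (R * onFirstTwo A) x y = ∑ p : Fin q × Fin q, R x ![p.1, p.2, y 2] * A p (y 0, y 1) := by
  simp only [onFirstTwo, mul_apply, of_apply, sum_quditBasis_three, Fintype.sum_prod_type]
  refine Finset.sum_congr rfl fun a _ => Finset.sum_congr rfl fun b _ => ?_
  rw [Finset.sum_eq_single (y 2)] <;> simp +contextual

theorem onLastTwo_mul_apply (A : TwoQuditOp q) (R : ThreeQuditOp q) (x y : QuditBasis q 3) :
    (onLastTwo A * R) x y = ∑ p : Fin q × Fin q, A (x 1, x 2) p * R ![x 0, p.1, p.2] y := by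
  simp only [onLastTwo, mul_apply, of_apply, sum_quditBasis_three, Fintype.sum_prod_type]
  rw [Finset.sum_eq_single (x 0)] <;> simp +contextual [eq_comm]

theorem mul_onLastTwo_apply (A : TwoQuditOp q) (R : ThreeQuditOp q) (x y : QuditBasis q 3) :
    (R * onLastTwo A) x y = ∑ p : Fin q × Fin q, R x ![y 0, p.1, p.2] * A p (y 1, y 2) := by
  simp only [onLastTwo, mul_apply, of_apply, sum_quditBasis_three, Fintype.sum_prod_type]
  rw [Finset.sum_eq_single (y 0)] <;> simp +contextual

theorem onFirstTwo_mul (A B : TwoQuditOp q) :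
    onFirstTwo (A * B) = onFirstTwo A * onFirstTwo B := by
  ext x y
  rw [onFirstTwo_mul_apply]
  simp [onFirstTwo, mul_apply]

theorem onLastTwo_mul (A B : TwoQuditOp q) :
    onLastTwo (A * B) = onLastTwo A * onLastTwo B := by
  ext x y
  rw [onLastTwo_mul_apply]
  simp [onLastTwo, mul_apply]

theorem onFirstTwo_conjTranspose (A : TwoQuditOp q) : onFirstTwo Aᴴ = (onFirstTwo A)ᴴ := by
  ext x y
  simp only [onFirstTwo, of_apply, conjTranspose_apply, eq_comm (a := x 2)]
  split_ifs <;> simp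

theorem onLastTwo_conjTranspose (A : TwoQuditOp q) : onLastTwo Aᴴ = (onLastTwo A)ᴴ := by
  ext x y
  simp only [onLastTwo, of_apply, conjTranspose_apply, eq_comm (a := x 0)]
  split_ifs <;> simp

theorem conjTranspose_onFirstTwo_mul_self (U : TwoQuditUnitary q) :
    (onFirstTwo (U : TwoQuditOp q))ᴴ * onFirstTwo (U : TwoQuditOp q) = 1 := by
  rw [← onFirstTwo_conjTranspose, ← onFirstTwo_mul, ← star_eq_conjTranspose,
    Unitary.coe_star_mul_self, onFirstTwo_one]

theorem conjTranspose_onLastTwo_mul_self (U : TwoQuditUnitary q) :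
    (onLastTwo (U : TwoQuditOp q))ᴴ * onLastTwo (U : TwoQuditOp q) = 1 := by
  rw [← onLastTwo_conjTranspose, ← onLastTwo_mul, ← star_eq_conjTranspose,
    Unitary.coe_star_mul_self, onLastTwo_one]

theorem trace_onFirstTwo_mul (A : TwoQuditOp q) (R : ThreeQuditOp q) :
    (onFirstTwo A * R).trace = (A * traceThird R).trace := by
  simp only [trace, diag_apply, onFirstTwo_mul_apply]
  simp only [sum_quditBasis_three, mul_apply, Fintype.sum_prod_type, traceThird, of_apply, Finset.mul_sum]
  refine Finset.sum_congr rfl fun a _ => Finset.sum_congr rfl fun b _ => ?_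
  rw [Finset.sum_comm]
  refine Finset.sum_congr rfl fun c _ => ?_
  rw [Finset.sum_comm]
  rfl

theorem trace_traceThird (R : ThreeQuditOp q) : (traceThird R).trace = R.trace := by
  have := trace_onFirstTwo_mul 1 R
  rw [onFirstTwo_one, one_mul, one_mul] at this
  exact this.symm

theorem traceThird_conj (U : TwoQuditUnitary q) (R : ThreeQuditOp q) :
    traceThird (onFirstTwo (U : TwoQuditOp q) * R * (onFirstTwo (U : TwoQuditOp q))ᴴ)
      = unitaryConj U (traceThird R) := by
  rw [← onFirstTwo_conjTranspose, unitaryConj_apply]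
  ext x y
  simp only [traceThird, of_apply, mul_onFirstTwo_apply, onFirstTwo_mul_apply]
  simp only [mul_apply, of_apply, Finset.sum_mul, Finset.mul_sum]
  rw [Finset.sum_comm]
  refine Finset.sum_congr rfl fun c _ => ?_
  rw [Finset.sum_comm]
  rfl

/-- A gate on the last two qudits conjugates each block ⟨a|R|b⟩ separately, which reduces its
average to `integral_unitaryConj`. -/
theorem onLastTwo_conj_apply (V : TwoQuditUnitary q) (R : ThreeQuditOp q) (x y : QuditBasis q 3) :
    (onLastTwo (V : TwoQuditOp q) * R * (onLastTwo (V : TwoQuditOp q))ᴴ) x y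
      = unitaryConj V (firstBlock R (x 0) (y 0)) (x 1, x 2) (y 1, y 2) := by
  rw [← onLastTwo_conjTranspose, unitaryConj_apply]
  simp only [firstBlock, mul_onLastTwo_apply, onLastTwo_mul_apply]
  simp only [mul_apply]
  rfl

theorem sum_traceThird (R : ThreeQuditOp q) (a b : Fin q) :
    ∑ w, traceThird R (a, w) (b, w) = (firstBlock R a b).trace := by
  simp [traceThird, firstBlock, trace, Fintype.sum_prod_type]

attribute [local instance] Matrix.normedAddCommGroup Matrix.normedSpace

/-- A Haar random gate on the last two qudits completely depolarizes the second qudit. -/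
theorem integral_trace_onFirstTwo_mul_conj [NeZero q] (A : TwoQuditOp q) (R : ThreeQuditOp q) :
    ∫ V : TwoQuditUnitary q, (onFirstTwo A *
      (onLastTwo (V : TwoQuditOp q) * R * (onLastTwo (V : TwoQuditOp q))ᴴ)).trace ∂haarTwoQudit q
      = (A * depolarizeSnd q (traceThird R)).trace := by
  have hq : (q : ℂ) ≠ 0 := NeZero.ne _
  have hc : ∀ X : TwoQuditOp q, Continuous fun V : TwoQuditUnitary q => unitaryConj V X :=
    fun X => continuous_unitaryConj continuous_id continuous_const
  have hi : ∀ X : TwoQuditOp q, ∀ x y, ∫ V, unitaryConj V X x y ∂haarTwoQudit q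
      = (X.trace / (q : ℂ) ^ 2) * (1 : TwoQuditOp q) x y := by
    intro X x y
    have h := integral_linearMap_comp (entryLinearMap ℂ ℂ x y) (hc X)
    rw [integral_unitaryConj] at h
    exact h
  have hint : ∀ (c : ℂ) (X : TwoQuditOp q) (x y), Integrable
      (fun V => c * unitaryConj V X x y) (haarTwoQudit q) := fun c X x y =>
    (continuous_const.mul ((hc X).matrix_elem x y)).integrable_of_hasCompactSupport
      (HasCompactSupport.of_compactSpace _)
  have hpt : ∀ V : TwoQuditUnitary q, (onFirstTwo A *
      (onLastTwo (V : TwoQuditOp q) * R * (onLastTwo (V : TwoQuditOp q))ᴴ)).trace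
      = ∑ x, ∑ y, ∑ c, A x y * unitaryConj V (firstBlock R y.1 x.1) (y.2, c) (x.2, c) := by
    intro V
    rw [trace_onFirstTwo_mul]
    simp only [traceThird, onLastTwo_conj_apply]
    simp only [trace, diag_apply, mul_apply, of_apply, Finset.mul_sum]
    rfl
  simp only [hpt]
  rw [integral_finsetSum _ fun _ _ => integrable_finsetSum _ fun _ _ =>
    integrable_finsetSum _ fun _ _ => hint _ _ _ _, trace]
  refine Finset.sum_congr rfl fun x _ => ?_
  rw [integral_finsetSum _ fun _ _ => integrable_finsetSum _ fun _ _ => hint _ _ _ _,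
    diag_apply, mul_apply]
  refine Finset.sum_congr rfl fun y _ => ?_
  rw [integral_finsetSum _ fun _ _ => hint _ _ _ _]
  simp only [integral_const_mul, hi, depolarizeSnd_apply, sum_traceThird]
  by_cases h : y.2 = x.2
  · simp [h, one_apply]
    field_simp
  · simp [h, one_apply]

end ThreeQudits

/-! ### The hybrid circuit on three qudits -/

section Circuit

open Matrix

namespace QuditCircuit

variable {q n : ℕ}

theorem toMatrix_append (C D : QuditCircuit q n) :
    toMatrix (C ++ D) = toMatrix D * toMatrix C := by
  induction C with
  | nil => simp [toMatrix]
  | cons g C ih => simp only [List.cons_append, toMatrix, ih, mul_assoc]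

theorem _root_.QuditGate.toMatrix_dagger (g : QuditGate q n) :
    g.dagger.toMatrix = g.toMatrixᴴ := by
  ext x y
  simp only [QuditGate.toMatrix, QuditGate.dagger, of_apply, conjTranspose_apply,
    eq_comm (a := x _)]
  split_ifs
  · rfl
  · simp

theorem toMatrix_reverse_map_dagger (C : QuditCircuit q n) :
    toMatrix (C.map QuditGate.dagger).reverse = (toMatrix C)ᴴ := by
  induction C with
  | nil => simp [toMatrix]
  | cons g C ih =>
    simp [toMatrix_append, toMatrix, ih, QuditGate.toMatrix_dagger]

/-- The gates of a circuit that act only on `I`. -/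
def idlePart (C : QuditCircuit q n) (I : Finset (Fin n)) : QuditCircuit q n :=
  C.filter fun g => decide (g.ActsOnlyOn I)

end QuditCircuit

variable {q : ℕ}

/-- Expectation of the operator `A ⊗ I`, evolved by the gates on the first two qudits, in the
operator `R`, evolved by the whole circuit. -/
def evolvedTrace (C : QuditCircuit q 3) (A : TwoQuditOp q) (R : ThreeQuditOp q) : ℂ :=
  ((C.idlePart (hybridIdle 3)).toMatrix * onFirstTwo A * (C.idlePart (hybridIdle 3)).toMatrixᴴ *
    (C.toMatrix * R * C.toMatrixᴴ)).trace

/-- The two gates of one layer. -/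
def layer (W V : TwoQuditUnitary q) : QuditCircuit q 3 :=
  [⟨0, 1, by decide, W⟩, ⟨1, 2, by decide, V⟩]

theorem toMatrix_layer (W V : TwoQuditUnitary q) :
    (layer W V).toMatrix = onLastTwo (V : TwoQuditOp q) * onFirstTwo (W : TwoQuditOp q) := by
  simp only [layer, QuditCircuit.toMatrix, one_mul]
  congr 1
  · ext x y
    simp [QuditGate.toMatrix, onLastTwo, Fin.forall_fin_succ]
  · ext x y
    simp [QuditGate.toMatrix, onFirstTwo, Fin.forall_fin_succ]

theorem toMatrix_idlePart_layer_append (W V : TwoQuditUnitary q) (C : QuditCircuit q 3) :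
    (QuditCircuit.idlePart (layer W V ++ C) (hybridIdle 3)).toMatrix
      = (C.idlePart (hybridIdle 3)).toMatrix * onFirstTwo (W : TwoQuditOp q) := by
  have h : QuditCircuit.idlePart (layer W V ++ C) (hybridIdle 3)
      = ⟨0, 1, by decide, W⟩ :: C.idlePart (hybridIdle 3) := by
    rw [QuditCircuit.idlePart, layer, List.cons_append, List.cons_append,
      List.filter_cons_of_pos (by simp [QuditGate.ActsOnlyOn, hybridIdle]),
      List.filter_cons_of_neg (by simp [QuditGate.ActsOnlyOn, hybridIdle])]
    rfl
  rw [h, QuditCircuit.toMatrix]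
  congr 1
  ext x y
  simp [QuditGate.toMatrix, onFirstTwo, Fin.forall_fin_succ]

/-- The first layer is the innermost factor on both sides of the trace, so it is absorbed into A and
R. Only W reaches A, because V touches the non-idle qudit. -/
theorem evolvedTrace_layer_append (W V : TwoQuditUnitary q) (C : QuditCircuit q 3)
    (A : TwoQuditOp q) (R : ThreeQuditOp q) :
    evolvedTrace (layer W V ++ C) A R = evolvedTrace C (unitaryConj W A)
      (onLastTwo (V : TwoQuditOp q) *
        (onFirstTwo (W : TwoQuditOp q) * R * (onFirstTwo (W : TwoQuditOp q))ᴴ) *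
        (onLastTwo (V : TwoQuditOp q))ᴴ) := by
  simp only [evolvedTrace, toMatrix_idlePart_layer_append, QuditCircuit.toMatrix_append,
    toMatrix_layer, unitaryConj_apply, onFirstTwo_mul, onFirstTwo_conjTranspose,
    conjTranspose_mul, mul_assoc]

/-! ### Recursion over layers for the Haar average -/

instance hybridHaar.instIsProbabilityMeasure (q n m : ℕ) :
    IsProbabilityMeasure (hybridHaar q n m) := by
  unfold hybridHaar; infer_instance

/-- Prepend a layer to a family of gates. -/
def consLayer {m : ℕ} (t : TwoQuditUnitary q × TwoQuditUnitary q × HybridUnitaries q 3 m) :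
    HybridUnitaries q 3 (m + 1) := fun li =>
  Fin.cases (motive := fun _ => TwoQuditUnitary q) (if li.2 = 0 then t.1 else t.2.1)
    (fun l => t.2.2 (l, li.2)) li.1

theorem hybridCircuit_consLayer {m : ℕ}
    (t : TwoQuditUnitary q × TwoQuditUnitary q × HybridUnitaries q 3 m) :
    hybridCircuit (consLayer t) = layer t.1 t.2.1 ++ hybridCircuit t.2.2 := by
  simp only [hybridCircuit, List.ofFn_succ (n := m), List.flatten_cons]
  rfl

theorem hybridCircuit_zero (U : HybridUnitaries q 3 0) : hybridCircuit U = [] := by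
  simp [hybridCircuit]

theorem continuous_consLayer {m : ℕ} : Continuous (consLayer (q := q) (m := m)) := by
  refine continuous_pi fun li => ?_
  obtain ⟨l, i⟩ := li
  refine Fin.cases ?_ (fun l => ?_) l
  · simp only [consLayer, Fin.cases_zero]
    split_ifs
    · exact continuous_fst
    · exact continuous_fst.comp continuous_snd
  · simp only [consLayer, Fin.cases_succ]
    exact (continuous_apply _).comp (continuous_snd.comp continuous_snd)

theorem measurePreserving_consLayer {m : ℕ} : MeasurePreserving (consLayer (q := q) (m := m))
    ((haarTwoQudit q).prod ((haarTwoQudit q).prod (hybridHaar q 3 m)))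
    (hybridHaar q 3 (m + 1)) := by
  refine ⟨continuous_consLayer.measurable, ?_⟩
  refine (Measure.pi_eq fun s hs => ?_).symm
  rw [Measure.map_apply continuous_consLayer.measurable (MeasurableSet.univ_pi hs)]
  have hpre : consLayer (q := q) (m := m) ⁻¹' Set.pi Set.univ s
      = s (0, 0) ×ˢ (s (0, 1) ×ˢ Set.pi Set.univ fun li => s (li.1.succ, li.2)) := by
    ext t
    simp only [Set.mem_preimage, Set.mem_pi, Set.mem_univ, true_implies, Prod.forall,
      Fin.forall_fin_succ (n := m), Set.mem_prod]
    constructor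
    · rintro ⟨h0, h1⟩
      exact ⟨h0 0, h0 1, h1⟩
    · rintro ⟨h0, h1, h2⟩
      refine ⟨fun i => ?_, h2⟩
      have hi : i = 0 ∨ i = 1 := by
        have := i.isLt
        simp only [Fin.ext_iff]
        change (i : ℕ) = 0 ∨ (i : ℕ) = 1
        omega
      rcases hi with rfl | rfl
      · exact h0
      · exact h1
  rw [hpre, Measure.prod_prod, Measure.prod_prod, hybridHaar, Measure.pi_pi,
    Fintype.prod_prod_type, Fintype.prod_prod_type, Fin.prod_univ_succ (n := m), ← mul_assoc]
  congr 1
  exact (Fin.prod_univ_two (fun i : Fin 2 => haarTwoQudit q (s (0, i)))).symm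

theorem continuous_onFirstTwo : Continuous (onFirstTwo (q := q)) := by
  refine continuous_matrix fun x y => ?_
  simp only [onFirstTwo, of_apply]
  split_ifs
  · exact continuous_id.matrix_elem _ _
  · exact continuous_const

theorem continuous_onLastTwo : Continuous (onLastTwo (q := q)) := by
  refine continuous_matrix fun x y => ?_
  simp only [onLastTwo, of_apply]
  split_ifs
  · exact continuous_id.matrix_elem _ _
  · exact continuous_const

/-- The first layer and the remaining ones. -/
theorem consLayer_split {m : ℕ} (U : HybridUnitaries q 3 (m + 1)) :
    consLayer (U (0, 0), U (0, 1), fun li => U (li.1.succ, li.2)) = U := by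
  funext ⟨l, i⟩
  refine Fin.cases ?_ (fun l => ?_) l
  · have hi : i = 0 ∨ i = 1 := by
      have := i.isLt
      simp only [Fin.ext_iff]
      change (i : ℕ) = 0 ∨ (i : ℕ) = 1
      omega
    rcases hi with rfl | rfl <;> rfl
  · rfl

/-- Continuity on the compact space of gates supplies the integrability that Fubini requires. A and
R vary with the parameter because peeling a layer makes them depend on its gates. -/
theorem continuous_evolvedTrace {α : Type*} [TopologicalSpace α] {m : ℕ}
    {f : α → HybridUnitaries q 3 m} {A : α → TwoQuditOp q} {R : α → ThreeQuditOp q}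
    (hf : Continuous f) (hA : Continuous A) (hR : Continuous R) :
    Continuous fun x => evolvedTrace (hybridCircuit (f x)) (A x) (R x) := by
  induction m generalizing A R with
  | zero =>
    simp only [hybridCircuit_zero, evolvedTrace, QuditCircuit.idlePart, List.filter_nil,
      QuditCircuit.toMatrix, conjTranspose_one, one_mul, mul_one]
    exact ((continuous_onFirstTwo.comp hA).mul hR).matrix_trace
  | succ m ih =>
    have hU : ∀ li, Continuous fun x => f x li := fun li => (continuous_apply li).comp hf
    have hU' : ∀ li, Continuous fun x => (f x li : TwoQuditOp q) := fun li =>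
      continuous_subtype_val.comp (hU li)
    have h : (fun x => evolvedTrace (hybridCircuit (f x)) (A x) (R x)) = fun x =>
        evolvedTrace (hybridCircuit fun li : Fin m × Fin (3 - 1) => f x (li.1.succ, li.2))
          (unitaryConj (f x (0, 0)) (A x))
          (onLastTwo (f x (0, 1) : TwoQuditOp q) *
            (onFirstTwo (f x (0, 0) : TwoQuditOp q) * R x *
              (onFirstTwo (f x (0, 0) : TwoQuditOp q))ᴴ) *
            (onLastTwo (f x (0, 1) : TwoQuditOp q))ᴴ) := by
      funext x
      conv_lhs => rw [← consLayer_split (f x)]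
      rw [hybridCircuit_consLayer, evolvedTrace_layer_append]
    rw [h]
    have hW := continuous_onFirstTwo.comp (hU' (0, 0))
    have hV := continuous_onLastTwo.comp (hU' (0, 1))
    exact ih (continuous_pi fun li => hU _) (continuous_unitaryConj (hU _) hA)
      ((hV.mul ((hW.mul hR).mul hW.matrix_conjTranspose)).mul hV.matrix_conjTranspose)

theorem trace_conj_of_conjTranspose_mul_self {n : Type*} [Fintype n] [DecidableEq n]
    {U : Matrix n n ℂ} (hU : Uᴴ * U = 1) (R : Matrix n n ℂ) : (U * R * Uᴴ).trace = R.trace := by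
  rw [trace_mul_comm, ← mul_assoc, hU, one_mul]

theorem integral_const_add_const_mul {f : TwoQuditUnitary q → ℂ} (hf : Continuous f) (c k : ℂ) :
    ∫ W, (c + k * f W) ∂haarTwoQudit q = c + k * ∫ W, f W ∂haarTwoQudit q := by
  rw [integral_add (integrable_const _)
    ((hf.integrable_of_hasCompactSupport (HasCompactSupport.of_compactSpace _)).const_mul k),
    integral_const_mul]
  simp

/-- With r = 1/(1+q²), a layer sends Tr[(A ⊗ I) R] to r times the sum of itself and Tr A Tr R. The
first coefficient is thus r + r² + ⋯ + r^m = (1 - r^m)/q². A and R stay general since the induction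
changes them. -/
theorem integral_evolvedTrace [NeZero q] (m : ℕ) (A : TwoQuditOp q) (R : ThreeQuditOp q) :
    ∫ U, evolvedTrace (hybridCircuit U) A R ∂hybridHaar q 3 m
      = (1 - (1 / (1 + (q : ℂ) ^ 2)) ^ m) / (q : ℂ) ^ 2 * (A.trace * R.trace)
        + (1 / (1 + (q : ℂ) ^ 2)) ^ m * (onFirstTwo A * R).trace := by
  induction m generalizing A R with
  | zero =>
    simp [hybridCircuit_zero, evolvedTrace, QuditCircuit.idlePart, QuditCircuit.toMatrix]
  | succ m ih =>
    have hq : (q : ℂ) ≠ 0 := NeZero.ne _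
    have hq2 := one_add_sq_ne_zero q
    have hcont : Continuous fun U : HybridUnitaries q 3 (m + 1) =>
        evolvedTrace (hybridCircuit U) A R :=
      continuous_evolvedTrace continuous_id continuous_const continuous_const
    have hcont' := hcont.comp (continuous_consLayer (q := q) (m := m))
    rw [← measurePreserving_consLayer.map_eq,
      integral_map continuous_consLayer.measurable.aemeasurable hcont.aestronglyMeasurable]
    simp only [hybridCircuit_consLayer, evolvedTrace_layer_append]
    simp only [Function.comp_def, hybridCircuit_consLayer, evolvedTrace_layer_append] at hcont'
    have hint := hcont'.integrable_of_hasCompactSupport (HasCompactSupport.of_compactSpace _)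
      (μ := (haarTwoQudit q).prod ((haarTwoQudit q).prod (hybridHaar q 3 m)))
    rw [integral_prod _ hint]
    have hinner : ∀ W : TwoQuditUnitary q,
        ∫ t : TwoQuditUnitary q × HybridUnitaries q 3 m,
          evolvedTrace (hybridCircuit t.2) (unitaryConj W A)
            (onLastTwo (t.1 : TwoQuditOp q) *
              (onFirstTwo (W : TwoQuditOp q) * R * (onFirstTwo (W : TwoQuditOp q))ᴴ) *
              (onLastTwo (t.1 : TwoQuditOp q))ᴴ) ∂(haarTwoQudit q).prod (hybridHaar q 3 m)
        = (1 - (1 / (1 + (q : ℂ) ^ 2)) ^ m) / (q : ℂ) ^ 2 * (A.trace * R.trace)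
          + (1 / (1 + (q : ℂ) ^ 2)) ^ m *
            (unitaryConj W A * depolarizeSnd q (unitaryConj W (traceThird R))).trace := by
      intro W
      have hcW : Continuous fun t : TwoQuditUnitary q × HybridUnitaries q 3 m =>
          evolvedTrace (hybridCircuit t.2) (unitaryConj W A)
            (onLastTwo (t.1 : TwoQuditOp q) *
              (onFirstTwo (W : TwoQuditOp q) * R * (onFirstTwo (W : TwoQuditOp q))ᴴ) *
              (onLastTwo (t.1 : TwoQuditOp q))ᴴ) := by
        have hV : Continuous fun t : TwoQuditUnitary q × HybridUnitaries q 3 m =>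
            onLastTwo (t.1 : TwoQuditOp q) :=
          continuous_onLastTwo.comp (continuous_subtype_val.comp continuous_fst)
        exact continuous_evolvedTrace continuous_snd continuous_const
          ((hV.mul continuous_const).mul hV.matrix_conjTranspose)
      rw [integral_prod _ (hcW.integrable_of_hasCompactSupport
        (HasCompactSupport.of_compactSpace _))]
      -- Traces are conjugation invariant, so only the second term of the induction hypothesis still
      -- depends on V and W.
      simp only [ih, trace_unitaryConj,
        trace_conj_of_conjTranspose_mul_self (conjTranspose_onLastTwo_mul_self _),
        trace_conj_of_conjTranspose_mul_self (conjTranspose_onFirstTwo_mul_self _)]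
      have hV : Continuous fun V : TwoQuditUnitary q => onLastTwo (V : TwoQuditOp q) :=
        continuous_onLastTwo.comp continuous_subtype_val
      have hf : Continuous fun V : TwoQuditUnitary q => (onFirstTwo (unitaryConj W A) *
          (onLastTwo (V : TwoQuditOp q) *
            (onFirstTwo (W : TwoQuditOp q) * R * (onFirstTwo (W : TwoQuditOp q))ᴴ) *
            (onLastTwo (V : TwoQuditOp q))ᴴ)).trace :=
        (continuous_const.mul ((hV.mul continuous_const).mul hV.matrix_conjTranspose)).matrix_trace
      rw [integral_const_add_const_mul hf, integral_trace_onFirstTwo_mul_conj, traceThird_conj]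
    simp only [hinner]
    have hΦ : Continuous fun W : TwoQuditUnitary q =>
        depolarizeSnd q (unitaryConj W (traceThird R)) :=
      (continuous_linearMap _).comp (continuous_unitaryConj continuous_id continuous_const)
    have hf : Continuous fun W : TwoQuditUnitary q =>
        (unitaryConj W A * depolarizeSnd q (unitaryConj W (traceThird R))).trace :=
      ((continuous_unitaryConj continuous_id continuous_const).mul hΦ).matrix_trace
    rw [integral_const_add_const_mul hf, integral_trace_unitaryConj_mul_depolarizeSnd,
      trace_traceThird, ← trace_onFirstTwo_mul]
    rw [pow_succ _ m]
    generalize (1 / (1 + (q : ℂ) ^ 2)) ^ m = r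
    field_simp
    ring

/-! ### The reset fidelity and its limit -/

/-- The projector `|0⟩⟨0| ⊗ I` on two qudits. -/
def zeroProjectorFst (q : ℕ) [NeZero q] : TwoQuditOp q :=
  diagonal fun x => if x.1 = 0 then 1 else 0

theorem onFirstTwo_zeroProjectorFst [NeZero q] :
    onFirstTwo (zeroProjectorFst q) = zeroProjector q 3 0 := by
  ext x y
  simp only [onFirstTwo, zeroProjectorFst, zeroProjector, of_apply, diagonal_apply,
    quditBasis_three_ext (x := x), Prod.mk.injEq, ← ite_and]
  congr 1
  rw [eq_iff_iff]
  tauto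

theorem trace_zeroProjectorFst [NeZero q] : (zeroProjectorFst q).trace = q := by
  simp only [zeroProjectorFst, trace, diag_apply, diagonal_apply_eq, Fintype.sum_prod_type]
  rw [Finset.sum_comm]
  simp

/-- The rewinding circuit implements K†, so ψ = K† C v and ⟨ψ|A|ψ⟩ = Tr[K A K† · C v v† C†]. -/
theorem hybridFidelity_eq_evolvedTrace [NeZero q] {m : ℕ} (U : HybridUnitaries q 3 m) :
    hybridFidelity 0 U = evolvedTrace (hybridCircuit U) (zeroProjectorFst q)
      (vecMulVec (zeroState q 3) (star (zeroState q 3))) := by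
  have hrew : ((hybridCircuit U).rewinding (hybridIdle 3)).toMatrix
      = (((hybridCircuit U).idlePart (hybridIdle 3)).toMatrix)ᴴ :=
    QuditCircuit.toMatrix_reverse_map_dagger _
  rw [hybridFidelity, resetFidelity, QuditCircuit.rewoundState, hrew, evolvedTrace,
    onFirstTwo_zeroProjectorFst]
  set K := ((hybridCircuit U).idlePart (hybridIdle 3)).toMatrix
  set C := (hybridCircuit U).toMatrix
  set v := zeroState q 3
  rw [mul_vecMulVec, vecMulVec_mul, mul_vecMulVec, trace_vecMulVec, ← star_mulVec]
  simp only [← mulVec_mulVec]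
  rw [star_mulVec Kᴴ, conjTranspose_conjTranspose, ← dotProduct_mulVec, dotProduct_comm]

theorem hybridAvgFidelity_three [NeZero q] (m : ℕ) :
    hybridAvgFidelity q 3 m 0
      = 1 / (q : ℂ) + ((q : ℂ) - 1) / (q : ℂ) * (1 / (1 + (q : ℂ) ^ 2)) ^ m := by
  have hq : (q : ℂ) ≠ 0 := NeZero.ne _
  simp only [hybridAvgFidelity, hybridFidelity_eq_evolvedTrace, integral_evolvedTrace,
    trace_zeroProjectorFst, onFirstTwo_zeroProjectorFst, mul_vecMulVec, trace_vecMulVec]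
  have h1 : zeroState q 3 ⬝ᵥ star (zeroState q 3) = 1 := by simp [zeroState]
  have h2 : zeroProjector q 3 0 *ᵥ zeroState q 3 = zeroState q 3 := by
    ext x
    rw [zeroProjector, mulVec_diagonal]
    by_cases hx : x 0 = 0
    · simp [hx]
    · have : x ≠ fun _ => 0 := fun h => hx (congrFun h 0)
      simp [zeroState, this]
  rw [h2, h1]
  generalize (1 / (1 + (q : ℂ) ^ 2)) ^ m = r
  field_simp
  ring

theorem norm_one_div_one_add_sq_lt_one (q : ℕ) [NeZero q] : ‖1 / (1 + (q : ℂ) ^ 2)‖ < 1 := by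
  have h : (1 + (q : ℂ) ^ 2) = ((1 + q ^ 2 : ℕ) : ℂ) := by push_cast; rfl
  have hpos : 0 < q ^ 2 := pow_pos (Nat.pos_of_ne_zero (NeZero.ne q)) 2
  rw [h, norm_div, norm_one, Complex.norm_natCast, div_lt_one (by positivity)]
  exact_mod_cast (by omega : 1 < 1 + q ^ 2)

end Circuit
end

theorem mainTheorem6 (q : ℕ) [NeZero q] :
    (∀ m : ℕ,
      Integrable (fun U : HybridUnitaries q 3 m => hybridFidelity 0 U) (hybridHaar q 3 m) ∧
      hybridAvgFidelity q 3 m 0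
        = 1 / (q : ℂ) + ((q : ℂ) - 1) / (q : ℂ) * (1 / (1 + (q : ℂ) ^ 2)) ^ m) ∧
    Tendsto (fun m : ℕ => hybridAvgFidelity q 3 m 0) atTop (𝓝 (1 / (q : ℂ))) := by
  refine ⟨fun m => ⟨?_, hybridAvgFidelity_three m⟩, ?_⟩
  · simp only [hybridFidelity_eq_evolvedTrace]
    exact (continuous_evolvedTrace continuous_id continuous_const
      continuous_const).integrable_of_hasCompactSupport (HasCompactSupport.of_compactSpace _)
  · simp only [hybridAvgFidelity_three]
    simpa using ((tendsto_pow_atTop_nhds_zero_of_norm_lt_one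
      (norm_one_div_one_add_sq_lt_one q)).const_mul (((q : ℂ) - 1) / (q : ℂ))).const_add
        (1 / (q : ℂ))
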